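/- **Theorem.** Let $0<\theta<90^\circ$ and $h=\cot(\theta/2)$. Consider the open chain of nine solid triangles $T_1,\dots,T_9$ in the plane in which $T_i$ has base $x_{i-1}x_i$ and third vertex (apex) $y_i$, consecutive triangles $T_i,T_{i+1}$ are hinged at $x_i$, and $$(x_0,\dots,x_9)=\bigl((0,4),(0,2),(0,0),(0,2),(0,4),(h,3),(h,1),(0,0),(-h,1),(-h,3)\bigr),$$ $$(y_1,\dots,y_9)=\bigl((h,3),(h,1),(-h,1),(-h,3),(h,\tfrac{7+h^2}{2}),(0,2),(h,\tfrac{1-h^2}{2}),(-h,\tfrac{1-h^2}{2}),(0,2)\bigr).$$ (For $\theta=60^\circ$ all nine triangles are equilateral with side $2$; in general they are copies of one triangle at two different scales.) Then every $T_i$ is isosceles with apex angle $\theta$ at $y_i$ (opposite its base), no triangle contains a point of the interior of another one (so the chain is a self-touching configuration), and the chain is rigid: it cannot move at all except as a whole. That is, in every continuous motion on a time interval $[0,1]$ that starts at this position, moves each triangle rigidly, keeps the eight hinges $x_1,\dots,x_8$ joined, and at no time lets a point of one triangle lie in the interior of another (touching and sliding along the boundary are allowed), the position at each time is the image of the initial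 position under a single orientation-preserving isometry of the plane. -/

import Mathlib

open scoped Real unitInterval

noncomputable section

/-- A position in the plane (identified with `ℂ`) of an open chain of `n` triangles.  The `i`-th
triangle has base `[joint i, joint (i + 1)]` and third vertex `apex i`; consecutive triangles are
hinged at the common endpoint of their bases. -/
structure TriangleChain (n : ℕ) where
  /-- The successive vertices of the core polygonal chain. -/
  joint : Fin (n + 1) → ℂ
  /-- The vertices of the triangles opposite their bases. -/
  apex : Fin n → ℂ

namespace TriangleChain

variable {n : ℕ}

/-- The `i`-th solid (closed) triangle of the chain. -/
def triangle (P : TriangleChain n) (i : Fin n) : Set ℂ :=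
  convexHull ℝ {P.joint i.castSucc, P.joint i.succ, P.apex i}

/-- No point of one triangle lies in the interior of another one.  The triangles may touch along
their boundaries. -/
def NonOverlapping (P : TriangleChain n) : Prop :=
  ∀ i j : Fin n, i ≠ j → Disjoint (P.triangle i) (interior (P.triangle j))

/-- Every triangle of the chain is isosceles, with the base as the distinguished side and with
angle `θ` at the apex. -/
def IsIsosceles (P : TriangleChain n) (θ : ℝ) : Prop :=
  ∀ i : Fin n, dist (P.apex i) (P.joint i.castSucc) = dist (P.apex i) (P.joint i.succ) ∧
    EuclideanGeometry.angle (P.joint i.castSucc) (P.apex i) (P.joint i.succ) = θ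

/-- Corresponding triangles of the two chains have the same side lengths. -/
def SameLengths (P Q : TriangleChain n) : Prop :=
  ∀ i : Fin n,
    dist (P.joint i.castSucc) (P.joint i.succ) = dist (Q.joint i.castSucc) (Q.joint i.succ) ∧
    dist (P.apex i) (P.joint i.castSucc) = dist (Q.apex i) (Q.joint i.castSucc) ∧
    dist (P.apex i) (P.joint i.succ) = dist (Q.apex i) (Q.joint i.succ)

/-- `γ` is a motion of the hinged chain starting from `P`: it is continuous in time, every triangle
keeps its side lengths (so, by continuity, it moves as a rigid body without being reflected), the
hinges are kept (they are built into `TriangleChain`), and the triangles never overlap, although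
they may touch and slide along each other. -/
structure IsMotion (P : TriangleChain n) (γ : I → TriangleChain n) : Prop where
  start : γ 0 = P
  continuous_joint : ∀ k, Continuous fun t => (γ t).joint k
  continuous_apex : ∀ i, Continuous fun t => (γ t).apex i
  sameLengths : ∀ t, SameLengths (γ t) P
  nonOverlapping : ∀ t, (γ t).NonOverlapping

/-- The chain cannot move at all, apart from moving as a whole: in every motion, the position at
each time is the image of the initial one under one orientation-preserving isometry
`z ↦ u * z + v` of the plane. -/
def Rigid (P : TriangleChain n) : Prop :=
  ∀ γ : I → TriangleChain n, IsMotion P γ → ∀ t : I, ∃ u v : ℂ, ‖u‖ = 1 ∧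
    (∀ k, (γ t).joint k = u * P.joint k + v) ∧ ∀ i, (γ t).apex i = u * P.apex i + v

end TriangleChain

/-- The self-touching chain of nine isosceles triangles with apex angle `θ`, with `h = cot (θ / 2)`.
Triangles `0, 1, 2, 3, 5, 8` have a vertical base of length `2`, and triangles `4, 6, 7` are scaled
copies whose base is as long as a leg of the others.  Triangles `0, 1, 2, 3, 5, 8` fill the hexagon
around `(0, 2)`.  Triangles `6` and `7` hang below it, on its two lower sides, and triangle `4` sits
on its upper right side; all but triangle `4` form a figure that is symmetric in the vertical axis.
For `θ = π / 3` all nine triangles are equilateral of side `2`. -/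
def nineTriangles (θ : ℝ) : TriangleChain 9 :=
  let h : ℝ := Real.cot (θ / 2)
  { joint := ![⟨0, 4⟩, ⟨0, 2⟩, ⟨0, 0⟩, ⟨0, 2⟩, ⟨0, 4⟩, ⟨h, 3⟩, ⟨h, 1⟩, ⟨0, 0⟩, ⟨-h, 1⟩, ⟨-h, 3⟩]
    apex := ![⟨h, 3⟩, ⟨h, 1⟩, ⟨-h, 1⟩, ⟨-h, 3⟩, ⟨h, (7 + h ^ 2) / 2⟩, ⟨0, 2⟩,
      ⟨h, (1 - h ^ 2) / 2⟩, ⟨-h, (1 - h ^ 2) / 2⟩, ⟨0, 2⟩] }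

end

/-! After composing with isometries, the first base stands still. The times at which the normalised
chain is in its initial position form a closed set, and the time interval is connected, so it
suffices that this set is open. That is `eventually_eq_nineTrianglesOfCot`: a nearby congruent chain
without overlaps, with its first base in place, is the initial chain.

Two facts carry this. Non-overlapping triangles are separated by a line, and if they close up along
a common edge, the normal of that line tends to the normal of the edge (`exists_tendsto_separator`).
Hence the displacement `w` of a vertex held by two edges satisfies `f · w ≥ 0` and `g · w ≥ 0` with
known limits of `f` and `g`. On the other hand, equal edge vectors in length, `a` and `b`, satisfy
`(a + b) · (a - b) = 0`, an exact equation rather than a first-order one. If `E = ±(a + b)` lies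
strictly between `f` and `g`, then `E · w ≥ 0`, with equality only for `w = 0`
(`planeDot_nonneg_of_cone`). So an edge of fixed length whose ends may only move so as to lengthen
it, or only so as to shorten it, is stuck. Strictness uses `h > 1`, that is, an acute apex angle.

With triangles numbered from 0, this locks the base of triangle 4 to a leg of triangle 0, then
triangle 5, then triangle 1. Triangles 2 and 3 are then stretched straight, and triangles 6, 7, 8
are locked together. -/

open Filter Topology

/-! ### Scalar products, cross products and cones in the plane. -/

/-- The scalar product of two plane vectors. -/
def planeDot (z w : ℂ) : ℝ := z.re * w.re + z.im * w.im

/-- The signed area of the parallelogram spanned by two plane vectors. -/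
def planeCross (z w : ℂ) : ℝ := z.re * w.im - z.im * w.re

theorem continuous_planeDot : Continuous fun p : ℂ × ℂ => planeDot p.1 p.2 := by
  unfold planeDot; fun_prop

theorem continuous_planeCross : Continuous fun p : ℂ × ℂ => planeCross p.1 p.2 := by
  unfold planeCross; fun_prop

theorem Filter.Tendsto.planeDot {α : Type*} {l : Filter α} {f g : α → ℂ} {a b : ℂ}
    (hf : Tendsto f l (𝓝 a)) (hg : Tendsto g l (𝓝 b)) :
    Tendsto (fun t => _root_.planeDot (f t) (g t)) l (𝓝 (_root_.planeDot a b)) :=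
  (continuous_planeDot.tendsto (a, b)).comp (hf.prodMk_nhds hg)

theorem Filter.Tendsto.planeCross {α : Type*} {l : Filter α} {f g : α → ℂ} {a b : ℂ}
    (hf : Tendsto f l (𝓝 a)) (hg : Tendsto g l (𝓝 b)) :
    Tendsto (fun t => _root_.planeCross (f t) (g t)) l (𝓝 (_root_.planeCross a b)) :=
  (continuous_planeCross.tendsto (a, b)).comp (hf.prodMk_nhds hg)

theorem planeDot_sub_right (f a b : ℂ) : planeDot f (a - b) = planeDot f a - planeDot f b := by
  simp [planeDot]; ring

theorem planeDot_neg_left (f a : ℂ) : planeDot (-f) a = -planeDot f a := by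
  simp [planeDot]; ring

theorem planeDot_neg_sub (f a b : ℂ) : planeDot (-f) (a - b) = planeDot f (b - a) := by
  simp [planeDot]; ring

theorem planeDot_smul_left (c : ℝ) (f a : ℂ) : planeDot (c * f) a = c * planeDot f a := by
  simp [planeDot]; ring

theorem dist_sq_eq_planeDot (a b : ℂ) : dist a b ^ 2 = planeDot (a - b) (a - b) := by
  rw [Complex.dist_eq, Complex.sq_norm, Complex.normSq_apply]; rfl

theorem dist_eq_dist_iff_planeDot {a b c d : ℂ} :
    dist a b = dist c d ↔ planeDot (a - b) (a - b) = planeDot (c - d) (c - d) := by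
  rw [← dist_sq_eq_planeDot, ← dist_sq_eq_planeDot,
    pow_left_inj₀ dist_nonneg dist_nonneg two_ne_zero]

/-- Points equidistant from `c` differ by a vector orthogonal to the sum of their positions. -/
theorem planeDot_add_sub_eq_zero {a b c d : ℂ} (h : dist a c = dist b d) :
    planeDot ((a - c) + (b - d)) ((a - c) - (b - d)) = 0 := by
  rw [dist_eq_dist_iff_planeDot] at h
  simp only [planeDot, Complex.sub_re, Complex.sub_im, Complex.add_re, Complex.add_im] at h ⊢
  linarith

/-- A vector orthogonal to two independent vectors vanishes. -/
theorem eq_zero_of_planeDot_eq_zero {f g w : ℂ} (hfg : planeCross f g ≠ 0)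
    (hf : planeDot f w = 0) (hg : planeDot g w = 0) : w = 0 := by
  unfold planeCross planeDot at *
  apply Complex.ext
  · apply mul_left_cancel₀ hfg
    simp only [Complex.zero_re]
    linear_combination g.im * hf - f.im * hg
  · apply mul_left_cancel₀ hfg
    simp only [Complex.zero_im]
    linear_combination -g.re * hf + f.re * hg

/-- If `E` lies strictly between `f` and `g`, then `E` is nonnegative on the dual cone of `f` and
`g`, and positive away from the origin. -/
theorem planeDot_nonneg_of_cone {f g E w : ℂ} (hfg : 0 < planeCross f g)
    (hEg : 0 < planeCross E g) (hfE : 0 < planeCross f E) (hf : 0 ≤ planeDot f w)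
    (hg : 0 ≤ planeDot g w) : 0 ≤ planeDot E w ∧ (planeDot E w ≤ 0 → w = 0) := by
  -- Cramer's rule: `E` is a combination of `f` and `g` whose coefficients are positive by
  -- assumption.
  have key : planeCross f g * planeDot E w =
      planeCross E g * planeDot f w + planeCross f E * planeDot g w := by
    unfold planeCross planeDot; ring
  have h1 := mul_nonneg hEg.le hf
  have h2 := mul_nonneg hfE.le hg
  refine ⟨nonneg_of_mul_nonneg_right (by rw [key]; positivity) hfg, fun h => ?_⟩
  have h3 : planeCross f g * planeDot E w ≤ 0 := mul_nonpos_of_nonneg_of_nonpos hfg.le h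
  refine eq_zero_of_planeDot_eq_zero hfg.ne' ?_ ?_
  · have : planeCross E g * planeDot f w = 0 := by linarith
    exact (mul_eq_zero.1 this).resolve_left hEg.ne'
  · have : planeCross f E * planeDot g w = 0 := by linarith
    exact (mul_eq_zero.1 this).resolve_left hfE.ne'

/-! ### Nearby points with prescribed distances, and limits of separating directions. -/

section Local

variable {α : Type*} {l : Filter α}

/-- The cone conditions are strict, hence open, so it is enough to check them on the limiting
directions. -/
theorem eventually_planeDot_nonneg_of_cone {f g E w : α → ℂ} {f₀ g₀ E₀ : ℂ}
    (tf : Tendsto f l (𝓝 f₀)) (tg : Tendsto g l (𝓝 g₀)) (tE : Tendsto E l (𝓝 E₀))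
    (hfg : 0 < planeCross f₀ g₀) (hEg : 0 < planeCross E₀ g₀) (hfE : 0 < planeCross f₀ E₀)
    (hf : ∀ᶠ t in l, 0 ≤ planeDot (f t) (w t)) (hg : ∀ᶠ t in l, 0 ≤ planeDot (g t) (w t)) :
    ∀ᶠ t in l, 0 ≤ planeDot (E t) (w t) ∧ (planeDot (E t) (w t) ≤ 0 → w t = 0) := by
  filter_upwards [hf, hg, (tf.planeCross tg).eventually_const_lt hfg,
    (tE.planeCross tg).eventually_const_lt hEg, (tf.planeCross tE).eventually_const_lt hfE]
    with t h1 h2 h3 h4 h5 using planeDot_nonneg_of_cone h3 h4 h5 h1 h2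

/-- A point close to `z₀` is determined by its distances from two points not collinear with
`z₀`. -/
theorem eventually_eq_of_dist_eq {z p q : α → ℂ} {z₀ p₀ q₀ : ℂ} (tz : Tendsto z l (𝓝 z₀))
    (hp : ∀ᶠ t in l, p t = p₀) (hq : ∀ᶠ t in l, q t = q₀)
    (hcross : planeCross (z₀ - p₀) (z₀ - q₀) ≠ 0)
    (dp : ∀ᶠ t in l, dist (z t) (p t) = dist z₀ p₀)
    (dq : ∀ᶠ t in l, dist (z t) (q t) = dist z₀ q₀) : ∀ᶠ t in l, z t = z₀ := by
  -- The displacement `z t - z₀` is orthogonal to two sums that tend to `2 (z₀ - p₀)` and `2 (z₀ -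
  -- q₀)`. These stay independent near the limit, which excludes the mirror image.
  have h1 := ((tz.sub_const p₀).add_const (z₀ - p₀)).planeCross
    ((tz.sub_const q₀).add_const (z₀ - q₀))
  have h2 : planeCross (z₀ - p₀ + (z₀ - p₀)) (z₀ - q₀ + (z₀ - q₀)) ≠ 0 := by
    have : planeCross (z₀ - p₀ + (z₀ - p₀)) (z₀ - q₀ + (z₀ - q₀)) =
        4 * planeCross (z₀ - p₀) (z₀ - q₀) := by
      simp only [planeCross, Complex.add_re, Complex.add_im]; ring
    rw [this]; positivity
  filter_upwards [hp, hq, dp, dq, h1.eventually_ne h2] with t a1 a2 a3 a4 a5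
  rw [a1] at a3
  rw [a2] at a4
  have b1 := planeDot_add_sub_eq_zero a3
  have b2 := planeDot_add_sub_eq_zero a4
  rw [sub_sub_sub_cancel_right] at b1 b2
  exact sub_eq_zero.1 (eq_zero_of_planeDot_eq_zero a5 b1 b2)

/-- If two convex bodies become adjacent along the segment `[p₀, q₀]` in the limit, then the
directions that separate them converge to the normal of this segment. -/
theorem exists_tendsto_separator {p q r p' q' : α → ℂ} {p₀ q₀ r₀ : ℂ}
    (tp : Tendsto p l (𝓝 p₀)) (tq : Tendsto q l (𝓝 q₀)) (tr : Tendsto r l (𝓝 r₀))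
    (tp' : Tendsto p' l (𝓝 p₀)) (tq' : Tendsto q' l (𝓝 q₀))
    (hpos : 0 < planeDot (Complex.I * (q₀ - p₀)) (r₀ - p₀))
    (sep : ∀ᶠ t in l, ∃ f : ℂ, f ≠ 0 ∧ ∀ a ∈ ({p t, q t, r t} : Set ℂ),
      ∀ b ∈ ({p' t, q' t} : Set ℂ), planeDot f b ≤ planeDot f a) :
    ∃ f : α → ℂ, Tendsto f l (𝓝 (Complex.I * (q₀ - p₀))) ∧
      (∀ᶠ t in l, 0 ≤ planeDot (f t) (p t - p' t)) ∧
      ∀ᶠ t in l, 0 ≤ planeDot (f t) (q t - q' t) := by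
  have hne : Complex.I * (q₀ - p₀) ≠ 0 := by
    intro h; rw [h] at hpos; simp [planeDot] at hpos
  set N := Complex.I * (q₀ - p₀) with hN
  have hN0 : 0 < ‖N‖ := norm_pos_iff.2 hne
  -- Normals are rescaled to the length of `N`, so that they live on a compact circle and
  -- convergence reduces to identifying the cluster points.
  have sep' : ∀ᶠ t in l, ∃ f : ℂ, ‖f‖ = ‖N‖ ∧ ∀ a ∈ ({p t, q t, r t} : Set ℂ),
      ∀ b ∈ ({p' t, q' t} : Set ℂ), planeDot f b ≤ planeDot f a := by
    filter_upwards [sep] with t ht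
    obtain ⟨f, hf, hs⟩ := ht
    have hf0 : 0 < ‖f‖ := norm_pos_iff.2 hf
    refine ⟨((‖N‖ / ‖f‖ : ℝ) : ℂ) * f, ?_, fun a ha b hb => ?_⟩
    · rw [norm_mul, Complex.norm_real, Real.norm_eq_abs, abs_of_pos (by positivity)]
      field_simp
    · rw [planeDot_smul_left, planeDot_smul_left]
      exact mul_le_mul_of_nonneg_left (hs a ha b hb) (by positivity)
  classical
  let f : α → ℂ := fun t => if h : ∃ f : ℂ, ‖f‖ = ‖N‖ ∧ ∀ a ∈ ({p t, q t, r t} : Set ℂ),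
      ∀ b ∈ ({p' t, q' t} : Set ℂ), planeDot f b ≤ planeDot f a then h.choose else 0
  have hf : ∀ᶠ t in l, ‖f t‖ = ‖N‖ ∧ ∀ a ∈ ({p t, q t, r t} : Set ℂ),
      ∀ b ∈ ({p' t, q' t} : Set ℂ), planeDot (f t) b ≤ planeDot (f t) a := by
    filter_upwards [sep'] with t ht
    simp only [f, dif_pos ht]
    exact ht.choose_spec
  refine ⟨f, ?_, ?_, ?_⟩
  · refine (isCompact_sphere (0 : ℂ) ‖N‖).tendsto_nhds_of_unique_mapClusterPt
      (hf.mono fun t ht => by simpa using ht.1) ?_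
    intro g hg hcl
    obtain ⟨U, hU, hUg⟩ := mapClusterPt_iff_ultrafilter.1 hcl
    have hfU := (hf.filter_mono hU).mono fun t ht => ht.2
    have le_of {a b : α → ℂ} {a₀ b₀ : ℂ} (ta : Tendsto a l (𝓝 a₀)) (tb : Tendsto b l (𝓝 b₀))
        (h : ∀ᶠ t in (U : Filter α), planeDot (f t) (b t) ≤ planeDot (f t) (a t)) :
        planeDot g b₀ ≤ planeDot g a₀ :=
      le_of_tendsto_of_tendsto (hUg.planeDot (tb.mono_left hU)) (hUg.planeDot (ta.mono_left hU)) h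
    -- Both bodies contain both ends of the segment in the limit, so a limiting normal `g` takes
    -- equal values there and is parallel to `N`. The third point `r₀` decides the sign.
    have h1 : planeDot g p₀ ≤ planeDot g q₀ :=
      le_of tq tp' (hfU.mono fun t ht => ht _ (by simp) _ (by simp))
    have h2 : planeDot g q₀ ≤ planeDot g p₀ :=
      le_of tp tq' (hfU.mono fun t ht => ht _ (by simp) _ (by simp))
    have h3 : planeDot g p₀ ≤ planeDot g r₀ :=
      le_of tr tp' (hfU.mono fun t ht => ht _ (by simp) _ (by simp))
    have hg' : planeDot g g = planeDot N N := by
      have := congrArg (· ^ 2) (show ‖g‖ = ‖N‖ by simpa using hg)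
      simp only [Complex.sq_norm, Complex.normSq_apply] at this
      exact this
    have h4 : planeCross N g = 0 := by
      have : planeCross N g = planeDot g p₀ - planeDot g q₀ := by
        simp [hN, planeCross, planeDot]; ring
      linarith
    have h5 : planeDot N N * planeDot g (r₀ - p₀) =
        planeDot N g * planeDot N (r₀ - p₀) + planeCross N g * planeCross N (r₀ - p₀) := by
      unfold planeDot planeCross; ring
    have hNN : 0 < planeDot N N := by
      have := pow_pos hN0 2
      rw [Complex.sq_norm, Complex.normSq_apply] at this
      exact this
    have h6 : 0 ≤ planeDot N g := by
      rw [h4, planeDot_sub_right g] at h5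
      have : 0 ≤ planeDot N N * (planeDot g r₀ - planeDot g p₀) :=
        mul_nonneg hNN.le (by linarith)
      exact nonneg_of_mul_nonneg_left (by linarith) hpos
    have h7 : planeDot N g ^ 2 = planeDot N N ^ 2 := by
      have : planeDot N g ^ 2 + planeCross N g ^ 2 = planeDot N N * planeDot g g := by
        unfold planeDot planeCross; ring
      rw [h4, hg'] at this; linarith
    have h8 : planeDot N g = planeDot N N := by
      rwa [pow_left_inj₀ h6 hNN.le two_ne_zero] at h7
    have h9 : planeDot (g - N) (g - N) = 0 := by
      have : planeDot (g - N) (g - N) = planeDot g g - 2 * planeDot N g + planeDot N N := by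
        simp only [planeDot, Complex.sub_re, Complex.sub_im]; ring
      linarith
    have h10 : ‖g - N‖ ^ 2 = 0 := by
      rw [Complex.sq_norm, Complex.normSq_apply]; exact h9
    exact sub_eq_zero.1 (norm_eq_zero.1 (pow_eq_zero_iff two_ne_zero |>.1 h10))
  · filter_upwards [hf] with t ht
    rw [planeDot_sub_right]
    exact sub_nonneg.2 (ht.2 _ (by simp) _ (by simp))
  · filter_upwards [hf] with t ht
    rw [planeDot_sub_right]
    exact sub_nonneg.2 (ht.2 _ (by simp) _ (by simp))

end Local

/-! ### Non-overlap as separation by lines. -/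

namespace TriangleChain

variable {n : ℕ}

/-- The vertices of the `i`-th triangle. -/
def vertices (P : TriangleChain n) (i : Fin n) : Set ℂ :=
  {P.joint i.castSucc, P.joint i.succ, P.apex i}

/-- The triangles `i` and `j` lie on different sides of a line, with normal vector `f`. -/
def Separated (P : TriangleChain n) (i j : Fin n) : Prop :=
  ∃ f : ℂ, f ≠ 0 ∧ ∀ a ∈ P.vertices i, ∀ b ∈ P.vertices j, planeDot f b ≤ planeDot f a

theorem left_mem_vertices (P : TriangleChain n) (i : Fin n) : P.joint i.castSucc ∈ P.vertices i :=
  Or.inl rfl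

theorem right_mem_vertices (P : TriangleChain n) (i : Fin n) : P.joint i.succ ∈ P.vertices i :=
  Or.inr (Or.inl rfl)

theorem apex_mem_vertices (P : TriangleChain n) (i : Fin n) : P.apex i ∈ P.vertices i :=
  Or.inr (Or.inr rfl)

theorem Separated.exists_planeDot_le {P : TriangleChain n} {i j : Fin n} (h : P.Separated i j)
    {p q r p' q' : ℂ} (hp : p ∈ P.vertices i) (hq : q ∈ P.vertices i) (hr : r ∈ P.vertices i)
    (hp' : p' ∈ P.vertices j) (hq' : q' ∈ P.vertices j) :
    ∃ f : ℂ, f ≠ 0 ∧ ∀ a ∈ ({p, q, r} : Set ℂ), ∀ b ∈ ({p', q'} : Set ℂ),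
      planeDot f b ≤ planeDot f a := by
  obtain ⟨f, hf, hs⟩ := h
  refine ⟨f, hf, ?_⟩
  rintro a (rfl | rfl | rfl) b (rfl | rfl) <;> exact hs _ (by assumption) _ (by assumption)

/-- Twice the signed area of the `i`-th triangle. -/
def signedArea (P : TriangleChain n) (i : Fin n) : ℝ :=
  planeCross (P.joint i.succ - P.joint i.castSucc) (P.apex i - P.joint i.castSucc)

theorem Separated.symm {P : TriangleChain n} {i j : Fin n} (h : P.Separated i j) :
    P.Separated j i := by
  obtain ⟨f, hf, hs⟩ := h
  refine ⟨-f, neg_ne_zero.2 hf, fun a ha b hb => ?_⟩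
  rw [planeDot_neg_left, planeDot_neg_left]
  exact neg_le_neg (hs b hb a ha)

theorem isLinearMap_planeDot (f : ℂ) : IsLinearMap ℝ (planeDot f) where
  map_add x y := by simp [planeDot]; ring
  map_smul c x := by simp [planeDot]; ring

/-- From an interior point of triangle `j` a small step along `f` stays in triangle `j`, so such a
point lies strictly below the separating level. -/
theorem Separated.disjoint {P : TriangleChain n} {i j : Fin n} (h : P.Separated i j) :
    Disjoint (P.triangle i) (interior (P.triangle j)) := by
  obtain ⟨f, hf, hs⟩ := h
  obtain ⟨c, hc1, hc2⟩ : ∃ c : ℝ, (∀ a ∈ P.vertices i, c ≤ planeDot f a) ∧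
      ∀ b ∈ P.vertices j, planeDot f b ≤ c := by
    have hfin : (P.vertices i).Finite := by unfold vertices; exact Set.toFinite _
    have hne : (P.vertices i).Nonempty := ⟨_, Or.inl rfl⟩
    obtain ⟨a, ha, hmin⟩ := Set.exists_min_image _ (planeDot f) hfin hne
    exact ⟨planeDot f a, hmin, hs a ha⟩
  have h1 : P.triangle i ⊆ {z | c ≤ planeDot f z} :=
    convexHull_min hc1 (convex_halfSpace_ge (isLinearMap_planeDot f) c)
  have h2 : P.triangle j ⊆ {z | planeDot f z ≤ c} :=
    convexHull_min hc2 (convex_halfSpace_le (isLinearMap_planeDot f) c)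
  rw [Set.disjoint_left]
  intro z hz hzj
  have hff : 0 < planeDot f f := by
    have := pow_pos (norm_pos_iff.2 hf) 2
    rw [Complex.sq_norm, Complex.normSq_apply] at this
    exact this
  have hcont : Continuous fun s : ℝ => z + s * f := by fun_prop
  have hmem : ∀ᶠ s : ℝ in 𝓝 0, z + s * f ∈ P.triangle j :=
    (hcont.tendsto' 0 z (by simp)).eventually (mem_interior_iff_mem_nhds.1 hzj)
  obtain ⟨s, hs, hs0⟩ := ((hmem.filter_mono nhdsWithin_le_nhds).and
    (self_mem_nhdsWithin : Set.Ioi (0 : ℝ) ∈ 𝓝[>] 0)).exists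
  have h3 : planeDot f (z + s * f) ≤ c := h2 hs
  have h4 : c ≤ planeDot f z := h1 hz
  have h5 : planeDot f (z + s * f) = planeDot f z + s * planeDot f f := by
    simp [planeDot]; ring
  have : 0 < s * planeDot f f := mul_pos hs0 hff
  linarith

/-- Congruent triangles have the same area. -/
theorem SameLengths.signedArea_ne_zero {P Q : TriangleChain n} (h : SameLengths Q P) {i : Fin n}
    (hP : P.signedArea i ≠ 0) : Q.signedArea i ≠ 0 := by
  obtain ⟨h1, h2, h3⟩ := h i
  rw [dist_eq_dist_iff_planeDot] at h1 h2 h3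
  -- Heron's formula: the squared area depends on the side lengths only.
  have heron : ∀ a b c : ℂ, 4 * planeCross (b - a) (c - a) ^ 2 =
      4 * planeDot (a - b) (a - b) * planeDot (c - a) (c - a) -
      (planeDot (a - b) (a - b) + planeDot (c - a) (c - a) - planeDot (c - b) (c - b)) ^ 2 := by
    intro a b c
    simp only [planeCross, planeDot, Complex.sub_re, Complex.sub_im]; ring
  have key : Q.signedArea i ^ 2 = P.signedArea i ^ 2 := by
    have e1 := heron (P.joint i.castSucc) (P.joint i.succ) (P.apex i)
    have e2 := heron (Q.joint i.castSucc) (Q.joint i.succ) (Q.apex i)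
    rw [h1, h2, h3, ← e1] at e2
    unfold signedArea; linarith
  intro h0
  rw [h0] at key
  exact hP (pow_eq_zero_iff two_ne_zero |>.1 (by linarith))

theorem interior_triangle_nonempty {P : TriangleChain n} {i : Fin n} (h : P.signedArea i ≠ 0) :
    (interior (P.triangle i)).Nonempty := by
  rw [triangle, interior_convexHull_nonempty_iff_affineSpan_eq_top, eq_top_iff]
  set a := P.joint i.castSucc with ha
  set b := P.joint i.succ with hb
  set c := P.apex i with hc
  have hA : planeCross (b - a) (c - a) ≠ 0 := h
  intro z _
  set s := planeCross (z - a) (c - a) / planeCross (b - a) (c - a)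
  set t := planeCross (b - a) (z - a) / planeCross (b - a) (c - a)
  have hz : z = s • (b - a) + t • (c - a) + a := by
    apply Complex.ext
    · simp only [s, t, Complex.add_re, Complex.real_smul, Complex.re_ofReal_mul, Complex.sub_re]
      field_simp
      simp only [planeCross, Complex.sub_re, Complex.sub_im]; ring
    · simp only [s, t, Complex.add_im, Complex.real_smul, Complex.im_ofReal_mul, Complex.sub_im]
      field_simp
      simp only [planeCross, Complex.sub_re, Complex.sub_im]; ring
  have ma : a ∈ affineSpan ℝ ({a, b, c} : Set ℂ) := subset_affineSpan _ _ (by simp)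
  have mb : b ∈ affineSpan ℝ ({a, b, c} : Set ℂ) := subset_affineSpan _ _ (by simp)
  have mc : c ∈ affineSpan ℝ ({a, b, c} : Set ℂ) := subset_affineSpan _ _ (by simp)
  have hd := (affineSpan ℝ ({a, b, c} : Set ℂ)).direction.add_mem
    (Submodule.smul_mem _ s (AffineSubspace.vsub_mem_direction mb ma))
    (Submodule.smul_mem _ t (AffineSubspace.vsub_mem_direction mc ma))
  have := AffineSubspace.vadd_mem_of_mem_direction hd ma
  rw [hz]
  simpa using this

/-- Hahn–Banach separates triangle `i` from the interior of triangle `j`. Nondegeneracy is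
essential: it makes this interior nonempty, hence the functional nonzero, and dense in triangle `j`,
hence the inequality valid at its vertices. -/
theorem NonOverlapping.separated {P : TriangleChain n} (hP : P.NonOverlapping) {i j : Fin n}
    (hij : i ≠ j) (hj : P.signedArea j ≠ 0) : P.Separated i j := by
  have hne := interior_triangle_nonempty hj
  have hconv : Convex ℝ (P.triangle j) := convex_convexHull ℝ _
  obtain ⟨f, u, h1, h2⟩ := geometric_hahn_banach_open hconv.interior isOpen_interior
    (convex_convexHull ℝ _ : Convex ℝ (P.triangle i)) (hP i j hij).symm
  have hval : ∀ z, f z = planeDot ⟨f 1, f Complex.I⟩ z := by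
    intro z
    have hz : z = z.re • (1 : ℂ) + z.im • Complex.I := by simp
    conv_lhs => rw [hz, map_add, map_smul, map_smul]
    simp [planeDot]; ring
  refine ⟨⟨f 1, f Complex.I⟩, fun h0 => ?_, fun a ha b hb => ?_⟩
  · obtain ⟨z, hz⟩ := hne
    have e1 := h1 z hz
    have e2 := h2 _ (subset_convexHull ℝ _ (Or.inl rfl))
    rw [hval, h0] at e1 e2
    simp [planeDot] at e1 e2
    linarith
  · rw [← hval, ← hval]
    refine le_trans ?_ (h2 a (subset_convexHull ℝ _ ha))
    have hcl : b ∈ closure (interior (P.triangle j)) := by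
      rw [hconv.closure_interior_eq_closure_of_nonempty_interior hne]
      exact subset_closure (subset_convexHull ℝ _ hb)
    exact closure_minimal (fun z hz => (h1 z hz).le)
      (isClosed_le f.continuous continuous_const) hcl

/-- The image of a chain under the map `z ↦ w * (z - c) + d`. -/
def move (P : TriangleChain n) (w c d : ℂ) : TriangleChain n where
  joint k := w * (P.joint k - c) + d
  apex i := w * (P.apex i - c) + d

theorem Separated.move {P : TriangleChain n} {i j : Fin n} (h : P.Separated i j) {w : ℂ}
    (hw : w ≠ 0) (c d : ℂ) : (P.move w c d).Separated i j := by
  obtain ⟨f, hf, hs⟩ := h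
  have key : ∀ z, planeDot (w * f) (w * (z - c) + d) =
      Complex.normSq w * planeDot f z - Complex.normSq w * planeDot f c + planeDot (w * f) d := by
    intro z
    simp [planeDot, Complex.normSq_apply]; ring
  have hs' : ∀ a ∈ P.vertices i, ∀ b ∈ P.vertices j,
      planeDot (w * f) (w * (b - c) + d) ≤ planeDot (w * f) (w * (a - c) + d) := by
    intro a ha b hb
    rw [key, key]
    have := mul_le_mul_of_nonneg_left (hs a ha b hb) (Complex.normSq_nonneg w)
    linarith
  refine ⟨w * f, mul_ne_zero hw hf, ?_⟩
  simp only [vertices, TriangleChain.move, Set.mem_insert_iff, Set.mem_singleton_iff] at hs' ⊢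
  rintro a (rfl | rfl | rfl) b (rfl | rfl | rfl) <;> exact hs' _ (by simp) _ (by simp)

theorem SameLengths.move {P Q : TriangleChain n} (h : SameLengths Q P) {w : ℂ} (hw : ‖w‖ = 1)
    (c d : ℂ) : SameLengths (Q.move w c d) P := by
  have key : ∀ a b : ℂ, dist (w * (a - c) + d) (w * (b - c) + d) = dist a b := by
    intro a b
    rw [dist_add_right, Complex.dist_eq, ← mul_sub, norm_mul, hw, one_mul, sub_sub_sub_cancel_right,
      Complex.dist_eq]
  intro i
  simpa only [TriangleChain.move, key] using h i

end TriangleChain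

/-! ### Local rigidity of the chain. -/

/-- The chain `nineTriangles θ` in terms of `h = cot (θ / 2)`. -/
noncomputable def nineTrianglesOfCot (h : ℝ) : TriangleChain 9 where
  joint := ![⟨0, 4⟩, ⟨0, 2⟩, ⟨0, 0⟩, ⟨0, 2⟩, ⟨0, 4⟩, ⟨h, 3⟩, ⟨h, 1⟩, ⟨0, 0⟩, ⟨-h, 1⟩, ⟨-h, 3⟩]
  apex := ![⟨h, 3⟩, ⟨h, 1⟩, ⟨-h, 1⟩, ⟨-h, 3⟩, ⟨h, (7 + h ^ 2) / 2⟩, ⟨0, 2⟩,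
      ⟨h, (1 - h ^ 2) / 2⟩, ⟨-h, (1 - h ^ 2) / 2⟩, ⟨0, 2⟩]

namespace TriangleChain

/-- The chain `nineTrianglesOfCot h` is locally rigid: a nearby chain of congruent triangles without
overlaps, in which the first base is in place, coincides with it. -/
theorem eventually_eq_nineTrianglesOfCot {α : Type*} {l : Filter α} {h : ℝ} (hh : 1 < h)
    {Q : α → TriangleChain 9}
    (tj : ∀ k, Tendsto (fun t => (Q t).joint k) l (𝓝 ((nineTrianglesOfCot h).joint k)))
    (ta : ∀ i, Tendsto (fun t => (Q t).apex i) l (𝓝 ((nineTrianglesOfCot h).apex i)))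
    (len : ∀ t, SameLengths (Q t) (nineTrianglesOfCot h))
    (sep : ∀ t i j, i ≠ j → (Q t).Separated i j)
    (x0 : ∀ t, (Q t).joint 0 = ⟨0, 4⟩) (x1 : ∀ t, (Q t).joint 1 = ⟨0, 2⟩) :
    ∀ᶠ t in l, (∀ k, (Q t).joint k = (nineTrianglesOfCot h).joint k) ∧
      ∀ i, (Q t).apex i = (nineTrianglesOfCot h).apex i := by
  have hsq : 1 < h ^ 2 := by nlinarith
  have tx0 : Tendsto (fun t => (Q t).joint 0) l (𝓝 ⟨0, 4⟩) := tj 0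
  have tx1 : Tendsto (fun t => (Q t).joint 1) l (𝓝 ⟨0, 2⟩) := tj 1
  have tx2 : Tendsto (fun t => (Q t).joint 2) l (𝓝 ⟨0, 0⟩) := tj 2
  have tx3 : Tendsto (fun t => (Q t).joint 3) l (𝓝 ⟨0, 2⟩) := tj 3
  have tx4 : Tendsto (fun t => (Q t).joint 4) l (𝓝 ⟨0, 4⟩) := tj 4
  have tx5 : Tendsto (fun t => (Q t).joint 5) l (𝓝 ⟨h, 3⟩) := tj 5
  have tx6 : Tendsto (fun t => (Q t).joint 6) l (𝓝 ⟨h, 1⟩) := tj 6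
  have tx7 : Tendsto (fun t => (Q t).joint 7) l (𝓝 ⟨0, 0⟩) := tj 7
  have tx8 : Tendsto (fun t => (Q t).joint 8) l (𝓝 ⟨-h, 1⟩) := tj 8
  have tx9 : Tendsto (fun t => (Q t).joint 9) l (𝓝 ⟨-h, 3⟩) := tj 9
  have ty0 : Tendsto (fun t => (Q t).apex 0) l (𝓝 ⟨h, 3⟩) := ta 0
  have ty1 : Tendsto (fun t => (Q t).apex 1) l (𝓝 ⟨h, 1⟩) := ta 1
  have ty2 : Tendsto (fun t => (Q t).apex 2) l (𝓝 ⟨-h, 1⟩) := ta 2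
  have ty3 : Tendsto (fun t => (Q t).apex 3) l (𝓝 ⟨-h, 3⟩) := ta 3
  have ty4 : Tendsto (fun t => (Q t).apex 4) l (𝓝 ⟨h, (7 + h ^ 2) / 2⟩) := ta 4
  have ty5 : Tendsto (fun t => (Q t).apex 5) l (𝓝 ⟨0, 2⟩) := ta 5
  have ty6 : Tendsto (fun t => (Q t).apex 6) l (𝓝 ⟨h, (1 - h ^ 2) / 2⟩) := ta 6
  have ty7 : Tendsto (fun t => (Q t).apex 7) l (𝓝 ⟨-h, (1 - h ^ 2) / 2⟩) := ta 7
  have ty8 : Tendsto (fun t => (Q t).apex 8) l (𝓝 ⟨0, 2⟩) := ta 8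
  have base (t) (i : Fin 9) := (len t i).1
  have leg (t) (i : Fin 9) := (len t i).2.1
  have leg' (t) (i : Fin 9) := (len t i).2.2
  have ne {i j : Fin 9} (hij : i ≠ j) : ∀ᶠ t in l, (Q t).Separated i j :=
    Eventually.of_forall fun t => sep t i j hij
  -- separating directions for the adjacent triangles
  obtain ⟨f04, tf04, f04p, f04q⟩ := exists_tendsto_separator ty0 tx0 tx1 tx5 tx4
    (by simp [planeDot]; linarith)
    ((ne (show (0 : Fin 9) ≠ 4 by decide)).mono fun t ht => ht.exists_planeDot_le
      (apex_mem_vertices _ _) (left_mem_vertices _ _) (right_mem_vertices _ _)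
      (right_mem_vertices _ _) (left_mem_vertices _ _))
  obtain ⟨f03, tf03, f03p, -⟩ := exists_tendsto_separator tx0 tx1 ty0 tx4 tx3
    (by simp [planeDot]; linarith)
    ((ne (show (0 : Fin 9) ≠ 3 by decide)).mono fun t ht => ht.exists_planeDot_le
      (left_mem_vertices _ _) (right_mem_vertices _ _) (apex_mem_vertices _ _)
      (right_mem_vertices _ _) (left_mem_vertices _ _))
  obtain ⟨f05, tf05, f05p, f05q⟩ := exists_tendsto_separator tx1 ty0 tx0 ty5 tx5
    (by simp [planeDot]; linarith)
    ((ne (show (0 : Fin 9) ≠ 5 by decide)).mono fun t ht => ht.exists_planeDot_le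
      (right_mem_vertices _ _) (apex_mem_vertices _ _) (left_mem_vertices _ _)
      (apex_mem_vertices _ _) (left_mem_vertices _ _))
  obtain ⟨f51, tf51, f51p, f51q⟩ := exists_tendsto_separator ty5 tx6 tx5 tx1 ty1
    (by simp [planeDot]; linarith)
    ((ne (show (5 : Fin 9) ≠ 1 by decide)).mono fun t ht => ht.exists_planeDot_le
      (apex_mem_vertices _ _) (right_mem_vertices _ _) (left_mem_vertices _ _)
      (left_mem_vertices _ _) (apex_mem_vertices _ _))
  obtain ⟨f16, tf16, f16p, f16q⟩ := exists_tendsto_separator tx2 ty1 tx1 tx7 tx6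
    (by simp [planeDot]; linarith)
    ((ne (show (1 : Fin 9) ≠ 6 by decide)).mono fun t ht => ht.exists_planeDot_le
      (right_mem_vertices _ _) (apex_mem_vertices _ _) (left_mem_vertices _ _)
      (right_mem_vertices _ _) (left_mem_vertices _ _))
  obtain ⟨f82, tf82, f82p, f82q⟩ := exists_tendsto_separator tx8 ty8 tx9 ty2 tx3
    (by simp [planeDot]; linarith)
    ((ne (show (8 : Fin 9) ≠ 2 by decide)).mono fun t ht => ht.exists_planeDot_le
      (left_mem_vertices _ _) (apex_mem_vertices _ _) (right_mem_vertices _ _)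
      (apex_mem_vertices _ _) (right_mem_vertices _ _))
  obtain ⟨f83, tf83, f83p, -⟩ := exists_tendsto_separator ty8 tx9 tx8 tx3 ty3
    (by simp [planeDot]; linarith)
    ((ne (show (8 : Fin 9) ≠ 3 by decide)).mono fun t ht => ht.exists_planeDot_le
      (apex_mem_vertices _ _) (right_mem_vertices _ _) (left_mem_vertices _ _)
      (left_mem_vertices _ _) (apex_mem_vertices _ _))
  have ex0 : ∀ᶠ t in l, (Q t).joint 0 = ⟨0, 4⟩ := Eventually.of_forall x0
  have ex1 : ∀ᶠ t in l, (Q t).joint 1 = ⟨0, 2⟩ := Eventually.of_forall x1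
  have ey0 : ∀ᶠ t in l, (Q t).apex 0 = ⟨h, 3⟩ :=
    eventually_eq_of_dist_eq ty0 ex0 ex1 (fun hc => by
      simp only [planeCross, Complex.sub_re, Complex.sub_im] at hc; nlinarith)
      (Eventually.of_forall fun t => leg t 0) (Eventually.of_forall fun t => leg' t 0)
  -- Triangles 3 and 4 keep `joint 4` in the outer wedge at one corner of triangle 0, and triangles
  -- 4 and 5 keep `joint 5` in the outer wedge at another. Both constraints push the ends of the
  -- base of triangle 4 apart, but its length is that of the leg between these corners.
  have e04 : ∀ᶠ t in l, (Q t).joint 4 = ⟨0, 4⟩ ∧ (Q t).joint 5 = ⟨h, 3⟩ := by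
    have tE := (ty0.sub tx0).add (tx5.sub tx4)
    filter_upwards [ex0, ey0,
      eventually_planeDot_nonneg_of_cone tf04 tf03 tE (by simp [planeCross]; nlinarith)
        (by simp [planeCross]; nlinarith) (by simp [planeCross]; nlinarith) f04q f03p,
      eventually_planeDot_nonneg_of_cone tf05 tf04 tE.neg (by simp [planeCross]; nlinarith)
        (by simp [planeCross]; nlinarith) (by simp [planeCross]; nlinarith) f05q f04p]
      with t h1 h2 h3 h4
    have h5 : dist ((Q t).apex 0) ((Q t).joint 0) = dist ((Q t).joint 5) ((Q t).joint 4) :=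
      ((leg t 0).trans (dist_comm _ _)).trans ((base t 4).symm.trans (dist_comm _ _))
    have h6 := planeDot_add_sub_eq_zero h5
    rw [sub_sub_sub_comm, planeDot_sub_right] at h6
    rw [planeDot_neg_left] at h4
    have h7 := sub_eq_zero.1 (h3.2 (by linarith))
    have h8 := sub_eq_zero.1 (h4.2 (by linarith))
    exact ⟨h7.symm.trans h1, h8.symm.trans h2⟩
  have ex4 := e04.mono fun t ht => ht.1
  have ex5 := e04.mono fun t ht => ht.2
  -- The apex of triangle 5 sits between triangles 0 and 1, at their hinge; leaving that corner
  -- would shorten the leg from `joint 5`.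
  have ey5 : ∀ᶠ t in l, (Q t).apex 5 = ⟨0, 2⟩ := by
    have tE := ((tx1.sub ty0).add (ty5.sub tx5)).neg
    filter_upwards [ex1, ey0, ex5,
      eventually_planeDot_nonneg_of_cone tf05.neg tf51 tE (by simp [planeCross]; nlinarith)
        (by simp [planeCross]; nlinarith) (by simp [planeCross]; nlinarith) (f05p.mono fun t ht => by rwa [planeDot_neg_sub]) f51p]
      with t h1 h2 h3 h4
    have h5 : dist ((Q t).joint 1) ((Q t).apex 0) = dist ((Q t).apex 5) ((Q t).joint 5) :=
      (dist_comm _ _).trans ((leg' t 0).trans ((dist_comm _ _).trans (leg t 5).symm))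
    have h6 := planeDot_add_sub_eq_zero h5
    have h7 : (Q t).joint 1 - (Q t).apex 0 - ((Q t).apex 5 - (Q t).joint 5) =
        (Q t).joint 1 - (Q t).apex 5 := by rw [h2, h3]; ring
    rw [h7] at h6
    rw [planeDot_neg_sub, h6] at h4
    exact (sub_eq_zero.1 (h4.2 le_rfl)).trans h1
  have ex6 : ∀ᶠ t in l, (Q t).joint 6 = ⟨h, 1⟩ :=
    eventually_eq_of_dist_eq tx6 ex5 ey5 (fun hc => by
      simp only [planeCross, Complex.sub_re, Complex.sub_im] at hc; nlinarith)
      (Eventually.of_forall fun t => (dist_comm _ _).trans ((base t 5).trans (dist_comm _ _))) (Eventually.of_forall fun t => (dist_comm _ _).trans ((leg' t 5).trans (dist_comm _ _)))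
  -- In the same way, the apex of triangle 1 is caught between triangles 5 and 6 at `joint 6`, and
  -- leaving it would shorten the leg from `joint 1`.
  have ey1 : ∀ᶠ t in l, (Q t).apex 1 = ⟨h, 1⟩ := by
    have tE := ((ty1.sub tx1).add (tx6.sub ty5)).neg
    filter_upwards [ex1, ey5, ex6,
      eventually_planeDot_nonneg_of_cone tf16 tf51.neg tE (by simp [planeCross]; nlinarith)
        (by simp [planeCross]; nlinarith) (by simp [planeCross]; nlinarith) f16q (f51q.mono fun t ht => by rwa [planeDot_neg_sub])]
      with t h1 h2 h3 h4
    have h5 : dist ((Q t).apex 1) ((Q t).joint 1) = dist ((Q t).joint 6) ((Q t).apex 5) :=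
      (leg t 1).trans ((dist_comm _ _).trans ((leg' t 5).symm.trans (dist_comm _ _)))
    have h6 := planeDot_add_sub_eq_zero h5
    have h7 : (Q t).apex 1 - (Q t).joint 1 - ((Q t).joint 6 - (Q t).apex 5) =
        (Q t).apex 1 - (Q t).joint 6 := by rw [h1, h2]; ring
    rw [h7] at h6
    rw [planeDot_neg_left, h6] at h4
    exact (sub_eq_zero.1 (h4.2 (by simp))).trans h3
  have ex2 : ∀ᶠ t in l, (Q t).joint 2 = ⟨0, 0⟩ :=
    eventually_eq_of_dist_eq tx2 ex1 ey1 (fun hc => by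
      simp only [planeCross, Complex.sub_re, Complex.sub_im] at hc; nlinarith)
      (Eventually.of_forall fun t => (dist_comm _ _).trans ((base t 1).trans (dist_comm _ _))) (Eventually.of_forall fun t => (dist_comm _ _).trans ((leg' t 1).trans (dist_comm _ _)))
  -- `joint 2` and `joint 4` are at distance 4, and `joint 3` is at distance 2 from each, so it is
  -- their midpoint.
  have ex3 : ∀ᶠ t in l, (Q t).joint 3 = ⟨0, 2⟩ := by
    filter_upwards [ex2, ex4] with t h2 h4
    have h5 : dist ((Q t).joint 2) ((Q t).joint 3) = dist (⟨0, 0⟩ : ℂ) ⟨0, 2⟩ := base t 2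
    have h6 : dist ((Q t).joint 3) ((Q t).joint 4) = dist (⟨0, 2⟩ : ℂ) ⟨0, 4⟩ := base t 3
    rw [h2, dist_eq_dist_iff_planeDot] at h5
    rw [h4, dist_eq_dist_iff_planeDot] at h6
    simp only [planeDot, Complex.sub_re, Complex.sub_im] at h5 h6
    have him : ((Q t).joint 3).im = 2 := by linarith
    rw [him] at h5
    have hre : ((Q t).joint 3).re = 0 := by
      have : ((Q t).joint 3).re ^ 2 = 0 := by linarith
      exact pow_eq_zero_iff two_ne_zero |>.1 this
    exact Complex.ext hre him
  have ey2 : ∀ᶠ t in l, (Q t).apex 2 = ⟨-h, 1⟩ :=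
    eventually_eq_of_dist_eq ty2 ex2 ex3 (fun hc => by
      simp only [planeCross, Complex.sub_re, Complex.sub_im] at hc; nlinarith)
      (Eventually.of_forall fun t => leg t 2) (Eventually.of_forall fun t => leg' t 2)
  have ey3 : ∀ᶠ t in l, (Q t).apex 3 = ⟨-h, 3⟩ :=
    eventually_eq_of_dist_eq ty3 ex3 ex4 (fun hc => by
      simp only [planeCross, Complex.sub_re, Complex.sub_im] at hc; nlinarith)
      (Eventually.of_forall fun t => leg t 3) (Eventually.of_forall fun t => leg' t 3)
  have ey4 : ∀ᶠ t in l, (Q t).apex 4 = ⟨h, (7 + h ^ 2) / 2⟩ :=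
    eventually_eq_of_dist_eq ty4 ex4 ex5 (fun hc => by
      simp only [planeCross, Complex.sub_re, Complex.sub_im] at hc; nlinarith)
      (Eventually.of_forall fun t => leg t 4) (Eventually.of_forall fun t => leg' t 4)
  -- The last three unknowns are coupled. `joint 7` moves on a circle about `joint 6`, on the outer
  -- side of triangle 1 (`c6`, `c7`). The apex of triangle 8 is in the wedge between triangles 2 and
  -- 3, and its leg passes this constraint on to `joint 8` (`c8`, `c9`, `c10`). Both ends of the
  -- base of triangle 7 can only move so as to lengthen it.
  have e78 : ∀ᶠ t in l, (Q t).joint 7 = ⟨0, 0⟩ ∧ (Q t).joint 8 = ⟨-h, 1⟩ ∧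
      (Q t).apex 8 = ⟨0, 2⟩ := by
    have tE := (tx7.sub tx6).add (tx2.sub ty1)
    have tF := (tx8.sub tx7).add (ty2.sub tx2)
    have tG := (tx8.sub ty8).add (ty2.sub tx3)
    have c6 : ∀ᶠ t in l, planeDot ((Q t).joint 7 - (Q t).joint 6 + ((Q t).joint 2 - (Q t).apex 1))
        ((Q t).joint 7 - (Q t).joint 2) = 0 := by
      filter_upwards [ey1, ex6] with t h1 h2
      have h5 : dist ((Q t).joint 7) ((Q t).joint 6) = dist ((Q t).joint 2) ((Q t).apex 1) :=
        (dist_comm _ _).trans ((base t 6).trans ((leg' t 1).symm.trans (dist_comm _ _)))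
      have h6 := planeDot_add_sub_eq_zero h5
      rw [sub_sub_sub_comm, h2.trans h1.symm, sub_self, sub_zero] at h6
      rwa [h2.trans h1.symm]
    have c7 := eventually_planeDot_nonneg_of_cone tf16.neg tE.neg tF.neg (by simp [planeCross]; nlinarith)
        (by simp [planeCross]; nlinarith) (by simp [planeCross]; nlinarith) (f16p.mono fun t ht => by rwa [planeDot_neg_sub])
        (c6.mono fun t ht => by rw [planeDot_neg_left, ht, neg_zero])
    have c8 := eventually_planeDot_nonneg_of_cone tf82 tf83 tG (by simp [planeCross]; nlinarith)
        (by simp [planeCross]; nlinarith) (by simp [planeCross]; nlinarith) f82q f83p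
    have c9 : ∀ᶠ t in l, planeDot ((Q t).joint 8 - (Q t).apex 8 + ((Q t).apex 2 - (Q t).joint 3))
        ((Q t).joint 8 - (Q t).apex 2) = planeDot ((Q t).joint 8 - (Q t).apex 8 +
        ((Q t).apex 2 - (Q t).joint 3)) ((Q t).apex 8 - (Q t).joint 3) := by
      refine Eventually.of_forall fun t => ?_
      have h5 : dist ((Q t).joint 8) ((Q t).apex 8) = dist ((Q t).apex 2) ((Q t).joint 3) :=
        (dist_comm _ _).trans ((leg t 8).trans ((dist_comm _ _).trans (leg' t 2).symm))
      have h6 := planeDot_add_sub_eq_zero h5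
      rw [sub_sub_sub_comm, planeDot_sub_right] at h6
      linarith
    have c10 := eventually_planeDot_nonneg_of_cone tf82 tG tF (by simp [planeCross]; nlinarith)
        (by simp [planeCross]; nlinarith) (by simp [planeCross]; nlinarith) f82p ((c8.and c9).mono fun t ht => by rw [ht.2]; exact ht.1.1)
    filter_upwards [ex2, ex3, ey2, c7, c8, c9, c10] with t h1 h2 h3 h4 h5 h6 h7
    have h8 : dist ((Q t).joint 8) ((Q t).joint 7) = dist ((Q t).apex 2) ((Q t).joint 2) :=
      (dist_comm _ _).trans ((base t 7).trans ((dist_comm _ _).trans (leg t 2).symm))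
    have h9 := planeDot_add_sub_eq_zero h8
    rw [sub_sub_sub_comm, planeDot_sub_right] at h9
    rw [planeDot_neg_left] at h4
    have h10 := h7.2 (by linarith)
    rw [h10] at h6
    exact ⟨(sub_eq_zero.1 (h4.2 (by linarith))).trans h1, (sub_eq_zero.1 h10).trans h3,
      (sub_eq_zero.1 (h5.2 (by rw [← h6]; simp [planeDot]))).trans h2⟩
  have ex7 := e78.mono fun t ht => ht.1
  have ex8 := e78.mono fun t ht => ht.2.1
  have ey8 := e78.mono fun t ht => ht.2.2
  have ex9 : ∀ᶠ t in l, (Q t).joint 9 = ⟨-h, 3⟩ :=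
    eventually_eq_of_dist_eq tx9 ex8 ey8 (fun hc => by
      simp only [planeCross, Complex.sub_re, Complex.sub_im] at hc; nlinarith)
      (Eventually.of_forall fun t => (dist_comm _ _).trans ((base t 8).trans (dist_comm _ _))) (Eventually.of_forall fun t => (dist_comm _ _).trans ((leg' t 8).trans (dist_comm _ _)))
  have ey6 : ∀ᶠ t in l, (Q t).apex 6 = ⟨h, (1 - h ^ 2) / 2⟩ :=
    eventually_eq_of_dist_eq ty6 ex6 ex7 (fun hc => by
      simp only [planeCross, Complex.sub_re, Complex.sub_im] at hc; nlinarith)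
      (Eventually.of_forall fun t => leg t 6) (Eventually.of_forall fun t => leg' t 6)
  have ey7 : ∀ᶠ t in l, (Q t).apex 7 = ⟨-h, (1 - h ^ 2) / 2⟩ :=
    eventually_eq_of_dist_eq ty7 ex7 ex8 (fun hc => by
      simp only [planeCross, Complex.sub_re, Complex.sub_im] at hc; nlinarith)
      (Eventually.of_forall fun t => leg t 7) (Eventually.of_forall fun t => leg' t 7)
  refine Eventually.and (eventually_all.2 fun k => ?_) (eventually_all.2 fun i => ?_)
  · fin_cases k
    exacts [ex0, ex1, ex2, ex3, ex4, ex5, ex6, ex7, ex8, ex9]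
  · fin_cases i
    exacts [ey0, ey1, ey2, ey3, ey4, ey5, ey6, ey7, ey8]

end TriangleChain

/-! ### The initial position: apex angles, areas and non-overlap. -/

theorem one_lt_cot_half {θ : ℝ} (h₀ : 0 < θ) (h₁ : θ < π / 2) : 1 < Real.cot (θ / 2) := by
  have hs : 0 < Real.sin (θ / 2) := Real.sin_pos_of_pos_of_lt_pi (by linarith) (by linarith)
  rw [Real.cot_eq_cos_div_sin, one_lt_div hs, ← Real.cos_pi_div_two_sub]
  exact Real.cos_lt_cos_of_nonneg_of_le_pi (by linarith) (by linarith) (by linarith)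

theorem cos_eq_cot_half {θ : ℝ} (h₀ : 0 < θ) (h₁ : θ < π / 2) :
    Real.cos θ * (Real.cot (θ / 2) ^ 2 + 1) = Real.cot (θ / 2) ^ 2 - 1 := by
  have hs : 0 < Real.sin (θ / 2) := Real.sin_pos_of_pos_of_lt_pi (by linarith) (by linarith)
  have h1 : Real.cos θ = Real.cos (θ / 2) ^ 2 - Real.sin (θ / 2) ^ 2 := by
    rw [← Real.cos_two_mul']; ring_nf
  have h2 := Real.sin_sq_add_cos_sq (θ / 2)
  rw [Real.cot_eq_cos_div_sin, h1]
  field_simp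
  rw [add_comm, h2, mul_one]

/-- A criterion for an isosceles triangle with prescribed apex angle. -/
theorem dist_eq_and_angle_eq {a b c : ℂ} {θ : ℝ} (h₀ : 0 ≤ θ) (h₁ : θ ≤ π) (hne : a ≠ c)
    (hd : planeDot (a - c) (a - c) = planeDot (b - c) (b - c))
    (hc : planeDot (a - c) (b - c) = Real.cos θ * planeDot (a - c) (a - c)) :
    dist c a = dist c b ∧ EuclideanGeometry.angle a c b = θ := by
  have hd' : dist a c = dist b c := dist_eq_dist_iff_planeDot.2 hd
  refine ⟨by rw [dist_comm c a, dist_comm c b, hd'], ?_⟩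
  have hpos : 0 < dist a c := dist_pos.2 hne
  have hin : inner ℝ (a - c) (b - c) = planeDot (a - c) (b - c) := by
    rw [Complex.inner]; simp [planeDot]; ring
  rw [EuclideanGeometry.angle, InnerProductGeometry.angle, vsub_eq_sub, vsub_eq_sub,
    ← dist_eq_norm, ← dist_eq_norm, ← hd', hin, hc, ← dist_sq_eq_planeDot, ← sq,
    mul_div_cancel_right₀ _ (pow_pos hpos 2).ne', Real.arccos_cos h₀ h₁]

namespace TriangleChain

theorem isIsosceles_nineTrianglesOfCot {θ h : ℝ} (h₀ : 0 ≤ θ) (h₁ : θ ≤ π) (hh : 0 < h)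
    (hcos : Real.cos θ * (h ^ 2 + 1) = h ^ 2 - 1) : (nineTrianglesOfCot h).IsIsosceles θ := by
  have large {a b c : ℂ} (hne : a ≠ c) (hd : planeDot (a - c) (a - c) = h ^ 2 + 1)
      (hd' : planeDot (b - c) (b - c) = h ^ 2 + 1) (hc : planeDot (a - c) (b - c) = h ^ 2 - 1) :
      dist c a = dist c b ∧ EuclideanGeometry.angle a c b = θ :=
    dist_eq_and_angle_eq h₀ h₁ hne (hd.trans hd'.symm) (by rw [hc, hd, hcos])
  -- Triangles 4, 6 and 7 are scaled by `√(h ^ 2 + 1) / 2`, so squared lengths are multiplied by `(h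
  -- ^ 2 + 1) / 4`.
  have small {a b c : ℂ} (hne : a ≠ c) (hd : planeDot (a - c) (a - c) = (h ^ 2 + 1) ^ 2 / 4)
      (hd' : planeDot (b - c) (b - c) = (h ^ 2 + 1) ^ 2 / 4)
      (hc : planeDot (a - c) (b - c) = (h ^ 2 - 1) * (h ^ 2 + 1) / 4) :
      dist c a = dist c b ∧ EuclideanGeometry.angle a c b = θ :=
    dist_eq_and_angle_eq h₀ h₁ hne (hd.trans hd'.symm) (by rw [hc, hd, ← hcos]; ring)
  intro i
  have hne : ∀ x y : ℝ, (⟨0, x⟩ : ℂ) ≠ ⟨h, y⟩ := fun x y e => hh.ne (congrArg Complex.re e)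
  have hne' : ∀ x y : ℝ, (⟨0, x⟩ : ℂ) ≠ ⟨-h, y⟩ := fun x y e =>
    (neg_ne_zero.2 hh.ne').symm (congrArg Complex.re e)
  have hne1 : h ^ 2 + 1 ≠ 0 := by positivity
  fin_cases i
  · apply large (hne _ _) <;> simp [planeDot, nineTrianglesOfCot] <;> ring
  · apply large (hne _ _) <;> simp [planeDot, nineTrianglesOfCot] <;> ring
  · apply large (hne' _ _) <;> simp [planeDot, nineTrianglesOfCot] <;> ring
  · apply large (hne' _ _) <;> simp [planeDot, nineTrianglesOfCot] <;> ring
  · apply small (hne _ _) <;> simp [planeDot, nineTrianglesOfCot] <;> ring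
  · apply large (hne _ _).symm <;> simp [planeDot, nineTrianglesOfCot] <;> ring
  · refine small (fun e => hne1 ?_) ?_ ?_ ?_
    · have : (1 : ℝ) = (1 - h ^ 2) / 2 := congrArg Complex.im e
      linarith
    all_goals simp [planeDot, nineTrianglesOfCot]; ring
  · apply small (hne' _ _) <;> simp [planeDot, nineTrianglesOfCot] <;> ring
  · apply large (hne' _ _).symm <;> simp [planeDot, nineTrianglesOfCot] <;> ring

theorem signedArea_nineTrianglesOfCot_ne_zero {h : ℝ} (hh : 0 < h) (i : Fin 9) :
    (nineTrianglesOfCot h).signedArea i ≠ 0 := by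
  have hsq : 0 < h ^ 2 := by positivity
  have hcu : 0 < h * h ^ 2 := by positivity
  intro hc
  fin_cases i <;>
    simp only [signedArea, planeCross, nineTrianglesOfCot, Complex.sub_re, Complex.sub_im] at hc <;>
    simp at hc <;> grind

theorem nonOverlapping_of_separated {n : ℕ} {P : TriangleChain n}
    (H : ∀ i j, i < j → P.Separated i j) : P.NonOverlapping := fun i j hij =>
  (lt_or_gt_of_ne hij).elim (fun h => (H i j h).disjoint) fun h => (H j i h).symm.disjoint

/-- The triangle `i` lies in the half-plane `c ≤ ⟪f, z⟫`. -/
def Above (P : TriangleChain 9) (f : ℂ) (c : ℝ) (i : Fin 9) : Prop :=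
  c ≤ planeDot f (P.joint i.castSucc) ∧ c ≤ planeDot f (P.joint i.succ) ∧ c ≤ planeDot f (P.apex i)

/-- The triangle `i` lies in the half-plane `⟪f, z⟫ ≤ c`. -/
def Below (P : TriangleChain 9) (f : ℂ) (c : ℝ) (i : Fin 9) : Prop :=
  planeDot f (P.joint i.castSucc) ≤ c ∧ planeDot f (P.joint i.succ) ≤ c ∧ planeDot f (P.apex i) ≤ c

theorem Above.separated {P : TriangleChain 9} {f : ℂ} {c : ℝ} {i j : Fin 9} (hi : P.Above f c i)
    (hj : P.Below f c j) (hf : f ≠ 0) : P.Separated i j := by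
  obtain ⟨h1, h2, h3⟩ := hi
  obtain ⟨h4, h5, h6⟩ := hj
  refine ⟨f, hf, ?_⟩
  rintro a (rfl | rfl | rfl) b (rfl | rfl | rfl) <;> exact le_trans (by assumption) (by assumption)

/-- Six lines separate all pairs: the vertical axis, the two other diagonals of the hexagon through
`(0, 2)`, and the three hexagon sides that carry triangles 4, 6 and 7. -/
theorem nonOverlapping_nineTrianglesOfCot {h : ℝ} (hh : 1 < h) :
    (nineTrianglesOfCot h).NonOverlapping := by
  have hsq : 1 < h ^ 2 := by nlinarith
  have hcu : h < h * h ^ 2 := by nlinarith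
  have hne : ∀ y : ℝ, (⟨-1, y⟩ : ℂ) ≠ 0 := fun y e => by
    have := congrArg Complex.re e
    norm_num at this
  have hne' : ∀ y : ℝ, (⟨1, y⟩ : ℂ) ≠ 0 := fun y e => by
    have := congrArg Complex.re e
    norm_num at this
  have vertical : ∀ i ∈ ({0, 1, 4, 5, 6} : Finset (Fin 9)), ∀ j ∈ ({2, 3, 7, 8} : Finset (Fin 9)),
      (nineTrianglesOfCot h).Separated i j := by
    have above : ∀ i ∈ ({0, 1, 4, 5, 6} : Finset (Fin 9)), (nineTrianglesOfCot h).Above ⟨1, 0⟩ 0 i := by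
      simp only [Finset.mem_insert, Finset.mem_singleton, forall_eq_or_imp, forall_eq]
      simp [Above, planeDot, nineTrianglesOfCot]
      nlinarith
    have below : ∀ i ∈ ({2, 3, 7, 8} : Finset (Fin 9)), (nineTrianglesOfCot h).Below ⟨1, 0⟩ 0 i := by
      simp only [Finset.mem_insert, Finset.mem_singleton, forall_eq_or_imp, forall_eq]
      simp [Below, planeDot, nineTrianglesOfCot]
      nlinarith
    exact fun i hi j hj => (above i hi).separated (below j hj) (hne' _)
  have rising : ∀ i ∈ ({0, 4, 8} : Finset (Fin 9)), ∀ j ∈ ({1, 2, 5, 6, 7} : Finset (Fin 9)),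
      (nineTrianglesOfCot h).Separated i j := by
    have above : ∀ i ∈ ({0, 4, 8} : Finset (Fin 9)), (nineTrianglesOfCot h).Above ⟨-1, h⟩ (2 * h) i := by
      simp only [Finset.mem_insert, Finset.mem_singleton, forall_eq_or_imp, forall_eq]
      simp [Above, planeDot, nineTrianglesOfCot]
      and_intros <;> nlinarith
    have below : ∀ i ∈ ({1, 2, 5, 6, 7} : Finset (Fin 9)), (nineTrianglesOfCot h).Below ⟨-1, h⟩ (2 * h) i := by
      simp only [Finset.mem_insert, Finset.mem_singleton, forall_eq_or_imp, forall_eq]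
      simp [Below, planeDot, nineTrianglesOfCot]
      and_intros <;> nlinarith
    exact fun i hi j hj => (above i hi).separated (below j hj) (hne _)
  have falling : ∀ i ∈ ({3, 5} : Finset (Fin 9)), ∀ j ∈ ({1, 2, 6, 7, 8} : Finset (Fin 9)),
      (nineTrianglesOfCot h).Separated i j := by
    have above : ∀ i ∈ ({3, 5} : Finset (Fin 9)), (nineTrianglesOfCot h).Above ⟨1, h⟩ (2 * h) i := by
      simp only [Finset.mem_insert, Finset.mem_singleton, forall_eq_or_imp, forall_eq]
      simp [Above, planeDot, nineTrianglesOfCot]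
      and_intros <;> nlinarith
    have below : ∀ i ∈ ({1, 2, 6, 7, 8} : Finset (Fin 9)), (nineTrianglesOfCot h).Below ⟨1, h⟩ (2 * h) i := by
      simp only [Finset.mem_insert, Finset.mem_singleton, forall_eq_or_imp, forall_eq]
      simp [Below, planeDot, nineTrianglesOfCot]
      and_intros <;> nlinarith
    exact fun i hi j hj => (above i hi).separated (below j hj) (hne' _)
  have top : ∀ i ∈ ({0} : Finset (Fin 9)), ∀ j ∈ ({4} : Finset (Fin 9)),
      (nineTrianglesOfCot h).Separated i j := by
    have above : ∀ i ∈ ({0} : Finset (Fin 9)), (nineTrianglesOfCot h).Above ⟨-1, -h⟩ (-4 * h) i := by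
      simp only [Finset.mem_singleton, forall_eq]
      simp [Above, planeDot, nineTrianglesOfCot]
      and_intros <;> nlinarith
    have below : ∀ i ∈ ({4} : Finset (Fin 9)), (nineTrianglesOfCot h).Below ⟨-1, -h⟩ (-4 * h) i := by
      simp only [Finset.mem_singleton, forall_eq]
      simp [Below, planeDot, nineTrianglesOfCot]
      and_intros <;> nlinarith
    exact fun i hi j hj => (above i hi).separated (below j hj) (hne _)
  have right : ∀ i ∈ ({1} : Finset (Fin 9)), ∀ j ∈ ({6} : Finset (Fin 9)),
      (nineTrianglesOfCot h).Separated i j := by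
    have above : ∀ i ∈ ({1} : Finset (Fin 9)), (nineTrianglesOfCot h).Above ⟨-1, h⟩ 0 i := by
      simp only [Finset.mem_singleton, forall_eq]
      simp [Above, planeDot, nineTrianglesOfCot]
      nlinarith
    have below : ∀ i ∈ ({6} : Finset (Fin 9)), (nineTrianglesOfCot h).Below ⟨-1, h⟩ 0 i := by
      simp only [Finset.mem_singleton, forall_eq]
      simp [Below, planeDot, nineTrianglesOfCot]
      nlinarith
    exact fun i hi j hj => (above i hi).separated (below j hj) (hne _)
  have left : ∀ i ∈ ({2} : Finset (Fin 9)), ∀ j ∈ ({7} : Finset (Fin 9)),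
      (nineTrianglesOfCot h).Separated i j := by
    have above : ∀ i ∈ ({2} : Finset (Fin 9)), (nineTrianglesOfCot h).Above ⟨1, h⟩ 0 i := by
      simp only [Finset.mem_singleton, forall_eq]
      simp [Above, planeDot, nineTrianglesOfCot]
      nlinarith
    have below : ∀ i ∈ ({7} : Finset (Fin 9)), (nineTrianglesOfCot h).Below ⟨1, h⟩ 0 i := by
      simp only [Finset.mem_singleton, forall_eq]
      simp [Below, planeDot, nineTrianglesOfCot]
      nlinarith
    exact fun i hi j hj => (above i hi).separated (below j hj) (hne' _)
  refine nonOverlapping_of_separated fun i j hij => ?_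
  fin_cases i <;> fin_cases j <;> first
    | exact absurd hij (by decide)
    | exact vertical _ (by decide) _ (by decide)
    | exact (vertical _ (by decide) _ (by decide)).symm
    | exact rising _ (by decide) _ (by decide)
    | exact (rising _ (by decide) _ (by decide)).symm
    | exact falling _ (by decide) _ (by decide)
    | exact (falling _ (by decide) _ (by decide)).symm
    | exact top _ (by decide) _ (by decide)
    | exact right _ (by decide) _ (by decide)
    | exact left _ (by decide) _ (by decide)

/-! ### From local to global rigidity. -/

theorem rigid_nineTrianglesOfCot {h : ℝ} (hh : 1 < h) : (nineTrianglesOfCot h).Rigid := by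
  intro γ hγ
  set P := nineTrianglesOfCot h with hP
  have h01 : P.joint 0 - P.joint 1 = 2 * Complex.I := by
    apply Complex.ext <;> simp [hP, nineTrianglesOfCot]; norm_num
  -- `u t` is the rotation taking the initial first base to its direction at time `t`; undoing it
  -- and the translation gives the chain `Q t` with fixed first base.
  let u : I → ℂ := fun t => ((γ t).joint 0 - (γ t).joint 1) / (2 * Complex.I)
  have hu : ∀ t, ‖u t‖ = 1 := by
    intro t
    have h1 : dist ((γ t).joint 0) ((γ t).joint 1) = dist (P.joint 0) (P.joint 1) :=
      (hγ.sameLengths t 0).1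
    rw [dist_eq_norm, dist_eq_norm, h01] at h1
    simp only [u]
    rw [norm_div, h1, div_self (by simp)]
  have hu0 : ∀ t, u t ≠ 0 := fun t => norm_ne_zero_iff.1 (by rw [hu]; exact one_ne_zero)
  have hucont : Continuous u :=
    ((hγ.continuous_joint 0).sub (hγ.continuous_joint 1)).div_const _
  let Q : I → TriangleChain 9 := fun t => (γ t).move (u t)⁻¹ ((γ t).joint 0) (P.joint 0)
  have hQj : ∀ k, Continuous fun t => (Q t).joint k := fun k =>
    ((hucont.inv₀ hu0).mul ((hγ.continuous_joint k).sub (hγ.continuous_joint 0))).add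
      continuous_const
  have hQa : ∀ i, Continuous fun t => (Q t).apex i := fun i =>
    ((hucont.inv₀ hu0).mul ((hγ.continuous_apex i).sub (hγ.continuous_joint 0))).add
      continuous_const
  have hQ0 : ∀ t, (Q t).joint 0 = P.joint 0 := fun t => by simp [Q, move]
  have hQ1 : ∀ t, (Q t).joint 1 = P.joint 1 := fun t => by
    have h1 : (γ t).joint 1 - (γ t).joint 0 = -(u t * (2 * Complex.I)) := by
      simp only [u]; rw [div_mul_cancel₀ _ (by simp)]; ring
    simp only [Q, move]
    rw [h1, ← h01, mul_neg, inv_mul_cancel_left₀ (hu0 t)]; ring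
  let S : Set I := {t | (∀ k, (Q t).joint k = P.joint k) ∧ ∀ i, (Q t).apex i = P.apex i}
  have hclosed : IsClosed S := by
    simp only [S, Set.ofPred_and, Set.ofPred_forall]
    exact (isClosed_iInter fun k => isClosed_eq (hQj k) continuous_const).inter
      (isClosed_iInter fun i => isClosed_eq (hQa i) continuous_const)
  have hopen : IsOpen S := by
    rw [isOpen_iff_mem_nhds]
    intro t ht
    refine eventually_eq_nineTrianglesOfCot hh (Q := Q)
      (fun k => (hQj k).tendsto' _ _ (ht.1 k)) (fun i => (hQa i).tendsto' _ _ (ht.2 i))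
      (fun s => (hγ.sameLengths s).move (by rw [norm_inv, hu, inv_one]) _ _)
      (fun s i j hij => ?_) hQ0 hQ1
    exact ((hγ.nonOverlapping s).separated hij ((hγ.sameLengths s).signedArea_ne_zero
      (signedArea_nineTrianglesOfCot_ne_zero (by linarith) j))).move (inv_ne_zero (hu0 s)) _ _
  have hzero : (0 : I) ∈ S := by
    have hg : γ 0 = P := hγ.start
    have hu1 : u 0 = 1 := by
      simp only [u]; rw [hg, h01, div_self (by simp)]
    constructor
    · intro k; simp only [Q, move]; rw [hu1, hg]; ring
    · intro i; simp only [Q, move]; rw [hu1, hg]; ring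
  -- Connectedness of the time interval turns local rigidity into rigidity at all times.
  have huniv : S = Set.univ := IsClopen.eq_univ ⟨hclosed, hopen⟩ ⟨0, hzero⟩
  intro t
  have ht : t ∈ S := huniv ▸ Set.mem_univ t
  refine ⟨u t, (γ t).joint 0 - u t * P.joint 0, hu t, fun k => ?_, fun i => ?_⟩
  · rw [← ht.1 k]; simp only [Q, move]
    rw [mul_add, mul_inv_cancel_left₀ (hu0 t)]; ring
  · rw [← ht.2 i]; simp only [Q, move]
    rw [mul_add, mul_inv_cancel_left₀ (hu0 t)]; ring

end TriangleChain

theorem mainTheorem6 (θ : ℝ) (hθ_pos : 0 < θ) (hθ_lt : θ < π / 2) :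
    (nineTriangles θ).IsIsosceles θ ∧ (nineTriangles θ).NonOverlapping ∧
      (nineTriangles θ).Rigid := by
  have hh := one_lt_cot_half hθ_pos hθ_lt
  have heq : nineTriangles θ = nineTrianglesOfCot (Real.cot (θ / 2)) := rfl
  rw [heq]
  exact ⟨TriangleChain.isIsosceles_nineTrianglesOfCot hθ_pos.le (by linarith) (by linarith)
    (cos_eq_cot_half hθ_pos hθ_lt), TriangleChain.nonOverlapping_nineTrianglesOfCot hh,
    TriangleChain.rigid_nineTrianglesOfCot hh⟩
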